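/- Let $P\ge 1$. For $M\ge 1$ and $\mu=(\mu_1,\dots,\mu_{2P})$ with all $\mu_i\ge 0$, let $\mathbf X_1,\dots,\mathbf X_M$ be independent and identically distributed $2P$-dimensional random vectors, where each $\mathbf X_m=(X_{m,1},\dots,X_{m,2P})$ has independent components $X_{m,i}\sim\mathrm{Pois}(\mu_i)$ (with $\mathrm{Pois}(0)$ the point mass at $0$). For data $\mathbb X=(\mathbf X_m)_{m=1}^M$ let $$\mathcal L(\mathbb X;\mu_1,\dots,\mu_{2P})=\prod_{m=1}^M\prod_{i=1}^{2P}e^{-\mu_i}\frac{\mu_i^{X_{m,i}}}{X_{m,i}!}$$ be the likelihood (with $0^0=1$), let $$r=\frac{\sup\{\mathcal L(\mathbb X;\nu_1,\nu_1,\nu_2,\nu_2,\dots,\nu_P,\nu_P):\ \nu_1,\dots,\nu_P\ge 0,\ \sum_i\nu_i>0\}}{\sup\{\mathcal L(\mathbb X;\mu_1,\dots,\mu_{2P}):\ \mu_1,\dots,\mu_{2P}\ge 0,\ \sum_i\mu_i>0\}}$$ be the likelihood ratio statistic for testing $\mu_{2i-1}=\mu_{2i}$ for all $1\le i\le P$,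 and let $R=-2\log r$. (1) The distribution of $R$ depends on $M$ and $\mu$ only through the products $\mu_iM$, $1\le i\le 2P$: if $(M,\mu)$ and $(M',\mu')$ satisfy $\mu_iM=\mu'_iM'$ for all $i$, then $R$ has the same distribution under both. (2) Suppose that $\mu_{2i-1}=\mu_{2i}=\mu_i^{pair}$ with $\mu_i^{pair}\ne 0$ for all $1\le i\le P$. Then $R$ converges in distribution to $\chi^2_P$, the chi-squared distribution with $P$ degrees of freedom, as $\mu_i^{pair}M\to\infty$ for every $1\le i\le P$; here both $M\ge 1$ and the $\mu_i^{pair}$ may vary arbitrarily, as long as all $P$ products tend to infinity. -/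

import Mathlib

open MeasureTheory ProbabilityTheory Filter
open scoped NNReal

noncomputable section

namespace PoissonPairs

/-- `X 0, …, X (M - 1)` are i.i.d. random vectors with values in `ℕ^(2P)`, each having independent
components with `X m i ∼ Pois(μ i)`. (The vectors are identically distributed because the law of a
vector with independent components is determined by its marginals.) -/
structure IsSample {Ω : Type*} [MeasurableSpace Ω] (Pr : Measure Ω) {M P : ℕ}
    (μ : Fin (2 * P) → ℝ≥0) (X : Fin M → Ω → (Fin (2 * P) → ℕ)) : Prop where
  indep_vectors : iIndepFun X Pr
  indep_components : ∀ m, iIndepFun (fun i ω => X m ω i) Pr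
  law : ∀ m i, HasLaw (fun ω => X m ω i) (poissonMeasure (μ i)) Pr

/-- The likelihood of the parameter vector `μ` for the observed counts `x`. -/
def likelihood {M P : ℕ} (x : Fin M → Fin (2 * P) → ℕ) (μ : Fin (2 * P) → ℝ≥0) : ℝ :=
  ∏ m, ∏ i, (poissonMeasure (μ i)).real {x m i}

/-- The vector `(ν₁, ν₁, ν₂, ν₂, …, ν_P, ν_P)`. -/
def paired {P : ℕ} (ν : Fin P → ℝ≥0) : Fin (2 * P) → ℝ≥0 :=
  fun j => ν ⟨j / 2, by omega⟩

/-- The likelihood ratio `r`: the supremum of the likelihood over the nonzero paired parameter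
vectors, divided by its supremum over all nonzero parameter vectors. -/
def likelihoodRatio {M P : ℕ} (x : Fin M → Fin (2 * P) → ℕ) : ℝ :=
  (⨆ ν : {ν : Fin P → ℝ≥0 // 0 < ∑ i, ν i}, likelihood x (paired ν.1)) /
    (⨆ μ : {μ : Fin (2 * P) → ℝ≥0 // 0 < ∑ i, μ i}, likelihood x μ.1)

/-- The test statistic `R = -2 log r`. -/
def statR {M P : ℕ} (x : Fin M → Fin (2 * P) → ℕ) : ℝ :=
  -2 * Real.log (likelihoodRatio x)

/-- The `χ²` distribution with `k` degrees of freedom: the law of the sum of the squares of `k`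
independent standard normal random variables. -/
def chiSquared (k : ℕ) : Measure ℝ :=
  (Measure.pi fun _ : Fin k => gaussianReal 0 1).map fun z => ∑ i, z i ^ 2

instance (k : ℕ) : IsProbabilityMeasure (chiSquared k) :=
  Measure.isProbabilityMeasure_map
    (Measurable.aemeasurable (by fun_prop))

end PoissonPairs

end

namespace PoissonPairs

open scoped Topology

/-! The data enter the likelihood only through the componentwise totals, apart from factorials that
cancel in the ratio. Both suprema are attained at explicit empirical means (or approached, when all
counts vanish), so `statR_eq` writes $R$ as a sum over pairs of `pairStat`, in which $M$ no longer
occurs. The totals are independent with laws $\mathrm{Pois}(\mu_iM)$, which gives (1).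

For (2), take one pair with totals $a,b\sim\mathrm{Pois}(r)$. A Taylor expansion shows that
`pairStat` differs from $(a-b)^2/(2r)$ by an error tending to $0$ in probability as $r\to\infty$
(`tendsto_measureReal_pairStat_sub`), while $(a-b)/\sqrt{2r}$ tends to a standard normal by
characteristic functions (`tendsto_map_scaledDiff`). So one pair has limit $\chi^2_1$ in the single
parameter $r$ (`tendsto_pairStatLaw`). Since product laws and pushforwards are weakly continuous,
the $P$ limits combine however the rates $r$ tend to infinity. -/

/-- The index `2p` of the first component of the `p`-th pair. -/
def fstIdx {P : ℕ} (p : Fin P) : Fin (2 * P) := ⟨2 * p, by omega⟩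

/-- The index `2p + 1` of the second component of the `p`-th pair. -/
def sndIdx {P : ℕ} (p : Fin P) : Fin (2 * P) := ⟨2 * p + 1, by omega⟩

lemma forall_fin_two_mul {P : ℕ} {q : Fin (2 * P) → Prop} :
    (∀ j, q j) ↔ ∀ p : Fin P, q (fstIdx p) ∧ q (sndIdx p) := by
  refine ⟨fun h p => ⟨h _, h _⟩, fun h j => ?_⟩
  have h' := h ⟨j / 2, by omega⟩
  rcases Nat.even_or_odd' (j : ℕ) with ⟨k, hk | hk⟩
  · convert h'.1
    simp [fstIdx, Fin.ext_iff]; omega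
  · convert h'.2
    simp [sndIdx, Fin.ext_iff]; omega

lemma prod_fin_two_mul {α : Type*} [CommMonoid α] {P : ℕ} (f : Fin (2 * P) → α) :
    ∏ j, f j = ∏ p, f (fstIdx p) * f (sndIdx p) := by
  rw [← (finProdFinEquiv.trans (finCongr (mul_comm P 2))).prod_comp f, Fintype.prod_prod_type]
  refine Finset.prod_congr rfl fun p _ => ?_
  rw [Fin.prod_univ_two]
  congr 2
  · ext; simp [fstIdx]
  · ext; simp [sndIdx]; ring

@[simp]
lemma paired_fstIdx {P : ℕ} (ν : Fin P → ℝ≥0) (p : Fin P) : paired ν (fstIdx p) = ν p := by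
  simp [paired, fstIdx]

@[simp]
lemma paired_sndIdx {P : ℕ} (ν : Fin P → ℝ≥0) (p : Fin P) : paired ν (sndIdx p) = ν p := by
  have : (2 * (p : ℕ) + 1) / 2 = p := by omega
  simp [paired, sndIdx, this]

/-! ### Maximum likelihood and the closed form of $R$ -/

/-- The componentwise sums of the observed counts. -/
def total {M P : ℕ} (x : Fin M → Fin (2 * P) → ℕ) : Fin (2 * P) → ℕ := ∑ m, x m

/-- The contribution of a pair with total counts `a` and `b` to the test statistic. -/
noncomputable def pairStat (ab : ℕ × ℕ) : ℝ :=
  2 * (ab.1 * Real.log ab.1 + ab.2 * Real.log ab.2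
    - (ab.1 + ab.2) * Real.log ((ab.1 + ab.2) / 2))

lemma likelihood_eq {M P : ℕ} (x : Fin M → Fin (2 * P) → ℕ) (μ : Fin (2 * P) → ℝ≥0) :
    likelihood x μ = (∏ m, ∏ i, ((x m i).factorial : ℝ)⁻¹) *
      ∏ i, (Real.exp (-(M * μ i)) * (μ i : ℝ) ^ total x i) := by
  simp only [likelihood, poissonMeasure_real_singleton, div_eq_mul_inv, Finset.prod_mul_distrib]
  rw [mul_comm]
  congr 1
  rw [Finset.prod_const, Finset.prod_comm, ← Finset.prod_pow]
  congr 1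
  · refine Finset.prod_congr rfl fun i _ => ?_
    rw [← Real.exp_nat_mul]
    simp
  · refine Finset.prod_congr rfl fun i _ => ?_
    rw [Finset.prod_pow_eq_pow_sum]
    simp [total]

lemma continuous_likelihood {M P : ℕ} (x : Fin M → Fin (2 * P) → ℕ) :
    Continuous (likelihood x) := by
  simp only [funext (likelihood_eq x)]
  fun_prop

lemma continuous_paired {P : ℕ} : Continuous (paired (P := P)) :=
  continuous_pi fun _ => continuous_apply _

/-- The maximum of a continuous function over the nonnegative orthant is also its supremum over
the nonzero vectors of the orthant. -/
lemma ciSup_pos_eq_of_forall_le {ι : Type*} [Fintype ι] [Nonempty ι] {F : (ι → ℝ≥0) → ℝ}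
    (hF : Continuous F) {v : ι → ℝ≥0} (hv : ∀ u, F u ≤ F v) :
    (⨆ u : {u : ι → ℝ≥0 // 0 < ∑ i, u i}, F u.1) = F v := by
  have pos (ε : ℝ≥0) (hε : 0 < ε) : 0 < ∑ i, (v i + ε) :=
    Finset.sum_pos (fun i _ => by positivity) Finset.univ_nonempty
  have : Nonempty {u : ι → ℝ≥0 // 0 < ∑ i, u i} := ⟨⟨fun i => v i + 1, pos 1 one_pos⟩⟩
  refine le_antisymm (ciSup_le fun u => hv u) ?_
  -- The maximiser `v` may be the excluded zero vector (all counts zero), so it is approached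
  -- through `v + ε`.
  have hlim : Tendsto (fun ε : ℝ≥0 => F fun i => v i + ε) (𝓝[>] 0) (𝓝 (F v)) := by
    have : Continuous fun ε : ℝ≥0 => F fun i => v i + ε := by fun_prop
    simpa using (this.tendsto 0).mono_left nhdsWithin_le_nhds
  refine le_of_tendsto hlim ?_
  filter_upwards [self_mem_nhdsWithin] with ε hε
  exact le_ciSup (f := fun u : {u : ι → ℝ≥0 // 0 < ∑ i, u i} => F u.1)
    ⟨F v, by rintro _ ⟨u, rfl⟩; exact hv u⟩ ⟨fun i => v i + ε, pos ε hε⟩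

/-- This is $1+x\le e^x$ at $x=\mu/\mu_0-1$, raised to the power $s=c\mu_0$. It is used with $c=M$
for a single component and $c=2M$ for a pair. -/
lemma exp_neg_mul_pow_le {c μ μ₀ : ℝ} {s : ℕ} (hc : 0 < c) (hμ : 0 ≤ μ) (h : c * μ₀ = s) :
    Real.exp (-(c * μ)) * μ ^ s ≤ Real.exp (-(c * μ₀)) * μ₀ ^ s := by
  rcases Nat.eq_zero_or_pos s with rfl | hs
  · have : μ₀ = 0 := by simpa [hc.ne'] using h
    simp [this]; positivity
  have hs' : (0 : ℝ) < s := by exact_mod_cast hs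
  have hμ₀ : 0 < μ₀ := pos_of_mul_pos_right (h ▸ hs') hc.le
  have key : μ ^ s ≤ μ₀ ^ s * Real.exp (c * μ - c * μ₀) := by
    have h1 : μ ≤ μ₀ * Real.exp (μ / μ₀ - 1) := by
      have := Real.add_one_le_exp (μ / μ₀ - 1)
      calc μ = μ₀ * (μ / μ₀ - 1 + 1) := by field_simp; ring
        _ ≤ _ := by gcongr
    calc μ ^ s ≤ (μ₀ * Real.exp (μ / μ₀ - 1)) ^ s := by gcongr
      _ = μ₀ ^ s * Real.exp (c * μ - c * μ₀) := by
        rw [mul_pow, ← Real.exp_nat_mul, ← h]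
        congr 2
        field_simp
  calc Real.exp (-(c * μ)) * μ ^ s
      ≤ Real.exp (-(c * μ)) * (μ₀ ^ s * Real.exp (c * μ - c * μ₀)) := by gcongr
    _ = Real.exp (-(c * μ₀)) * μ₀ ^ s := by
      rw [mul_left_comm, ← Real.exp_add, mul_comm]
      ring_nf

lemma iSup_likelihood {M P : ℕ} (hM : 1 ≤ M) (hP : 1 ≤ P) (x : Fin M → Fin (2 * P) → ℕ) :
    (⨆ μ : {μ : Fin (2 * P) → ℝ≥0 // 0 < ∑ i, μ i}, likelihood x μ.1)
      = likelihood x fun i => (total x i : ℝ≥0) / M := by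
  have : NeZero (2 * P) := ⟨by omega⟩
  refine ciSup_pos_eq_of_forall_le (continuous_likelihood x) fun μ => ?_
  have hM' : (0 : ℝ) < M := by exact_mod_cast hM
  rw [likelihood_eq, likelihood_eq]
  refine mul_le_mul_of_nonneg_left (Finset.prod_le_prod (fun i _ => by positivity) fun i _ => ?_)
    (by positivity)
  refine exp_neg_mul_pow_le hM' (by positivity) ?_
  push_cast
  field_simp

lemma likelihood_paired_eq {M P : ℕ} (x : Fin M → Fin (2 * P) → ℕ) (ν : Fin P → ℝ≥0) :
    likelihood x (paired ν) = (∏ m, ∏ i, ((x m i).factorial : ℝ)⁻¹) *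
      ∏ p, (Real.exp (-(2 * M * ν p)) * (ν p : ℝ) ^ (total x (fstIdx p) + total x (sndIdx p))) := by
  rw [likelihood_eq, prod_fin_two_mul fun i => Real.exp (-(M * paired ν i)) * _]
  congr 1
  refine Finset.prod_congr rfl fun p _ => ?_
  rw [paired_fstIdx, paired_sndIdx, mul_mul_mul_comm, ← Real.exp_add, ← pow_add]
  ring_nf

lemma iSup_likelihood_paired {M P : ℕ} (hM : 1 ≤ M) (hP : 1 ≤ P) (x : Fin M → Fin (2 * P) → ℕ) :
    (⨆ ν : {ν : Fin P → ℝ≥0 // 0 < ∑ i, ν i}, likelihood x (paired ν.1))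
      = likelihood x (paired fun p =>
        ((total x (fstIdx p) : ℝ≥0) + total x (sndIdx p)) / (2 * M)) := by
  have : NeZero P := ⟨by omega⟩
  refine ciSup_pos_eq_of_forall_le (F := fun ν => likelihood x (paired ν))
    ((continuous_likelihood x).comp continuous_paired) fun ν => ?_
  have hM' : (0 : ℝ) < M := by exact_mod_cast hM
  simp only [likelihood_paired_eq]
  refine mul_le_mul_of_nonneg_left (Finset.prod_le_prod (fun p _ => by positivity) fun p _ => ?_)
    (by positivity)
  refine exp_neg_mul_pow_le (by positivity) (by positivity) ?_
  push_cast
  field_simp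

/-- The exponentials cancel because both estimates predict the same total $a+b$ for a pair; the
$\log M$ terms cancel for the same reason. Zero counts are harmless: $0^0=1$ and $0\log 0=0$. -/
lemma statR_eq {M P : ℕ} (hM : 1 ≤ M) (hP : 1 ≤ P) (x : Fin M → Fin (2 * P) → ℕ) :
    statR x = ∑ p, pairStat (total x (fstIdx p), total x (sndIdx p)) := by
  have hM' : (0 : ℝ) < M := by exact_mod_cast hM
  have hC : (∏ m, ∏ i, ((x m i).factorial : ℝ)⁻¹) ≠ 0 := by
    simp [Finset.prod_ne_zero_iff, Nat.factorial_ne_zero]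
  have hden : ∀ p : Fin P, (Real.exp (-(M * ((total x (fstIdx p) / M : ℝ≥0) : ℝ))) *
      ((total x (fstIdx p) / M : ℝ≥0) : ℝ) ^ total x (fstIdx p)) *
      (Real.exp (-(M * ((total x (sndIdx p) / M : ℝ≥0) : ℝ))) *
      ((total x (sndIdx p) / M : ℝ≥0) : ℝ) ^ total x (sndIdx p)) ≠ 0 := by
    intro p
    have h (s : ℕ) : ((s / M : ℝ≥0) : ℝ) ^ s ≠ 0 := by
      rcases Nat.eq_zero_or_pos s with rfl | hs
      · simp
      · have : (0 : ℝ) < s := by exact_mod_cast hs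
        push_cast
        positivity
    have := h (total x (fstIdx p))
    have := h (total x (sndIdx p))
    positivity
  have hnum : ∀ p : Fin P, Real.exp (-(2 * M *
      (((total x (fstIdx p) + total x (sndIdx p)) / (2 * M) : ℝ≥0) : ℝ))) *
      (((total x (fstIdx p) + total x (sndIdx p)) / (2 * M) : ℝ≥0) : ℝ) ^
        (total x (fstIdx p) + total x (sndIdx p)) ≠ 0 := by
    intro p
    refine mul_ne_zero (Real.exp_ne_zero _) ?_
    rcases Nat.eq_zero_or_pos (total x (fstIdx p) + total x (sndIdx p)) with h | h
    · simp [h]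
    · have : (0 : ℝ) < total x (fstIdx p) + total x (sndIdx p) := by exact_mod_cast h
      push_cast
      positivity
  rw [statR, likelihoodRatio, iSup_likelihood hM hP, iSup_likelihood_paired hM hP,
    likelihood_paired_eq, likelihood_eq, mul_div_mul_left _ _ hC, prod_fin_two_mul,
    ← Finset.prod_div_distrib, Real.log_prod fun p _ => div_ne_zero (hnum p) (hden p),
    Finset.mul_sum]
  refine Finset.sum_congr rfl fun p _ => ?_
  have hlog (a c : ℝ) (hc : 0 < c) : a * Real.log (a / c) = a * Real.log a - a * Real.log c := by
    rcases eq_or_ne a 0 with rfl | ha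
    · simp
    · rw [Real.log_div ha hc.ne']; ring
  rw [Real.log_div (hnum p) (hden p), Real.log_mul (left_ne_zero_of_mul (hnum p))
    (right_ne_zero_of_mul (hnum p))]
  have h := hden p
  rw [Real.log_mul (left_ne_zero_of_mul h) (right_ne_zero_of_mul h),
    Real.log_mul (left_ne_zero_of_mul (left_ne_zero_of_mul h))
      (right_ne_zero_of_mul (left_ne_zero_of_mul h)),
    Real.log_mul (left_ne_zero_of_mul (right_ne_zero_of_mul h))
      (right_ne_zero_of_mul (right_ne_zero_of_mul h))]
  simp only [Real.log_exp, Real.log_pow, pairStat]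
  push_cast
  rw [← div_div, hlog _ _ hM', hlog _ _ hM', div_right_comm]
  set a : ℝ := (total x (fstIdx p) : ℝ)
  set b : ℝ := (total x (sndIdx p) : ℝ)
  have h3 : (a + b) * Real.log ((a + b) / M / 2)
      = (a + b) * Real.log ((a + b) / 2) - (a + b) * Real.log M := by
    rcases eq_or_ne (a + b) 0 with h | h
    · simp [h]
    · rw [div_right_comm, Real.log_div (by positivity) hM'.ne']; ring
  rw [h3]
  field_simp
  ring

/-! ### Law of the total counts -/

lemma pi_conv_pi {ι : Type*} [Fintype ι] (a b : ι → Measure ℕ) [∀ i, SigmaFinite (a i)]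
    [∀ i, SigmaFinite (b i)] [∀ i, SigmaFinite ((a i).conv (b i))] :
    (Measure.pi a).conv (Measure.pi b) = Measure.pi fun i => (a i).conv (b i) := by
  have hmp := measurePreserving_arrowProdEquivProdArrow ℕ ℕ ι a b
  rw [Measure.conv, ← hmp.map_eq, Measure.map_map (by fun_prop) hmp.measurable]
  have : ∀ i, SigmaFinite (Measure.map (fun x : ℕ × ℕ => x.1 + x.2) ((a i).prod (b i))) :=
    fun i => inferInstanceAs (SigmaFinite ((a i).conv (b i)))
  exact Measure.pi_map_pi (μ := fun i => (a i).prod (b i)) (f := fun _ (x : ℕ × ℕ) => x.1 + x.2)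
    fun i => by fun_prop

lemma pi_poissonMeasure_conv {ι : Type*} [Fintype ι] (a b : ι → ℝ≥0) :
    (Measure.pi fun i => poissonMeasure (a i)).conv (Measure.pi fun i => poissonMeasure (b i))
      = Measure.pi fun i => poissonMeasure (a i + b i) := by
  have (i : ι) : SigmaFinite ((poissonMeasure (a i)).conv (poissonMeasure (b i))) := by
    rw [poissonMeasure_conv_poissonMeasure]; infer_instance
  rw [pi_conv_pi]
  simp only [poissonMeasure_conv_poissonMeasure]

lemma hasLaw_sum_pi_poissonMeasure {Ω ι κ : Type*} [MeasurableSpace Ω] {Pr : Measure Ω}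
    [IsProbabilityMeasure Pr] [Fintype ι] {μ : ι → ℝ≥0} {X : κ → Ω → ι → ℕ}
    (hX : iIndepFun X Pr) (hlaw : ∀ m, HasLaw (X m) (Measure.pi fun i => poissonMeasure (μ i)) Pr)
    {s : Finset κ} (hs : s.Nonempty) :
    HasLaw (∑ m ∈ s, X m) (Measure.pi fun i => poissonMeasure (s.card * μ i)) Pr := by
  induction hs using Finset.Nonempty.cons_induction with
  | singleton m => simpa using hlaw m
  | cons m s hm hs ih =>
    rw [Finset.sum_cons, Finset.card_cons, add_comm]
    have hind := hX.indepFun_finsetSum_of_notMem₀ (fun m => (hlaw m).aemeasurable) hm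
    have := hind.hasLaw_add ih (hlaw m)
    rw [pi_poissonMeasure_conv] at this
    simpa [add_mul] using this

lemma IsSample.hasLaw_total {Ω : Type*} [MeasurableSpace Ω] {Pr : Measure Ω}
    [IsProbabilityMeasure Pr] {M P : ℕ} {μ : Fin (2 * P) → ℝ≥0}
    {X : Fin M → Ω → (Fin (2 * P) → ℕ)} (hM : 1 ≤ M) (h : IsSample Pr μ X) :
    HasLaw (fun ω => total fun m => X m ω)
      (Measure.pi fun i => poissonMeasure (μ i * M)) Pr := by
  have := hasLaw_sum_pi_poissonMeasure h.indep_vectors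
    (fun m => (h.indep_components m).hasLaw_pi (h.law m))
    (Finset.univ_nonempty_iff.2 ⟨⟨0, hM⟩⟩)
  convert this using 1
  · ext ω i; simp [total]
  · simp [mul_comm]

/-- Splitting a vector of length `2P` with independent components into `P` pairs. -/
lemma map_pairs_pi {P : ℕ} (μ : Fin (2 * P) → Measure ℕ) [∀ i, IsProbabilityMeasure (μ i)] :
    (Measure.pi μ).map (fun s p => (s (fstIdx p), s (sndIdx p)))
      = Measure.pi fun p : Fin P => (μ (fstIdx p)).prod (μ (sndIdx p)) := by
  -- `φ` undoes the pairing. It pulls boxes back to boxes, which identifies `Measure.pi μ` as a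
  -- pushforward under `φ`.
  let φ : (Fin P → ℕ × ℕ) → Fin (2 * P) → ℕ := fun y j =>
    if (j : ℕ) % 2 = 0 then (y ⟨j / 2, by omega⟩).1 else (y ⟨j / 2, by omega⟩).2
  have hφ_meas : Measurable φ := by
    refine measurable_pi_lambda _ fun j => ?_
    by_cases h : (j : ℕ) % 2 = 0
    · simp only [φ, h, if_true]; fun_prop
    · simp only [φ, h, if_false]; fun_prop
  have hfst (y : Fin P → ℕ × ℕ) (p : Fin P) : φ y (fstIdx p) = (y p).1 := by
    simp [φ, fstIdx]
  have hsnd (y : Fin P → ℕ × ℕ) (p : Fin P) : φ y (sndIdx p) = (y p).2 := by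
    have : (2 * (p : ℕ) + 1) / 2 = p := by omega
    simp [φ, sndIdx, Nat.add_mod, this]
  have hpi : Measure.pi μ
      = (Measure.pi fun p : Fin P => (μ (fstIdx p)).prod (μ (sndIdx p))).map φ := by
    refine (Measure.pi_eq fun s hs => ?_)
    have hpre : φ ⁻¹' (Set.univ.pi s)
        = Set.univ.pi fun p : Fin P => s (fstIdx p) ×ˢ s (sndIdx p) := by
      ext y
      simp only [Set.mem_preimage, Set.mem_univ_pi, Set.mem_prod,
        forall_fin_two_mul (q := fun j => φ y j ∈ s j), hfst, hsnd]
    rw [Measure.map_apply hφ_meas (MeasurableSet.univ_pi hs), hpre, Measure.pi_pi,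
      prod_fin_two_mul]
    simp [Measure.prod_prod]
  rw [hpi, Measure.map_map (by fun_prop) hφ_meas]
  convert Measure.map_id
  ext y p <;> simp [hfst, hsnd]

/-! ### A Slutsky lemma with varying measures -/

/-- If `X i` converges in distribution and `Y i - X i` tends to `0` in probability, where both the
measure and the random variables may depend on `i`, then `Y i` has the same limit. -/
lemma tendsto_map_of_tendsto_measureReal_abs_sub {ι Ω : Type*} [MeasurableSpace Ω] {l : Filter ι}
    [l.IsCountablyGenerated] {Q : ι → ProbabilityMeasure Ω} {X Y : ι → Ω → ℝ}
    (hX : ∀ i, Measurable (X i)) (hY : ∀ i, Measurable (Y i)) {ρ : ProbabilityMeasure ℝ}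
    (hlim : Tendsto (fun i => (Q i).map (hX i).aemeasurable) l (𝓝 ρ))
    (hsub : ∀ ε > 0, Tendsto (fun i => (Q i : Measure Ω).real {ω | ε ≤ |Y i ω - X i ω|}) l (𝓝 0)) :
    Tendsto (fun i => (Q i).map (hY i).aemeasurable) l (𝓝 ρ) := by
  rw [tendsto_iff_forall_lipschitz_integral_tendsto] at hlim ⊢
  rintro F ⟨C, hC⟩ ⟨L, hL⟩
  have hFm : Measurable F := hL.continuous.measurable
  have hC0 : 0 ≤ C := dist_nonneg.trans (hC 0 0)
  have hFint {i : ι} {Z : Ω → ℝ} (hZ : Measurable Z) :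
      Integrable (fun ω => F (Z ω)) (Q i : Measure Ω) := by
    refine Integrable.of_bound (hFm.comp hZ).aestronglyMeasurable (‖F 0‖ + C) (ae_of_all _ fun ω => ?_)
    have := hC (Z ω) 0
    rw [dist_eq_norm] at this
    linarith [norm_sub_norm_le (F (Z ω)) (F 0)]
  -- The Lipschitz bound `L * ε` serves where the variables are close, the oscillation bound `C`
  -- elsewhere.
  have hbound (i : ι) (ε : ℝ) (hε : 0 < ε) :
      |∫ x, F x ∂((Q i).map (hY i).aemeasurable : Measure ℝ)
        - ∫ x, F x ∂((Q i).map (hX i).aemeasurable : Measure ℝ)|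
      ≤ L * ε + C * (Q i : Measure Ω).real {ω | ε ≤ |Y i ω - X i ω|} := by
    have hA : MeasurableSet {ω | ε ≤ |Y i ω - X i ω|} :=
      measurableSet_le measurable_const (by fun_prop)
    rw [ProbabilityMeasure.toMeasure_map, ProbabilityMeasure.toMeasure_map,
      integral_map (by fun_prop) (by fun_prop), integral_map (by fun_prop) (by fun_prop),
      ← integral_sub (hFint (hY i)) (hFint (hX i)), ← Real.norm_eq_abs]
    have hI : Integrable (fun ω => L * ε + Set.indicator {ω | ε ≤ |Y i ω - X i ω|}
        (fun _ => C) ω) (Q i : Measure Ω) :=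
      (integrable_const _).add ((integrable_const C).indicator hA)
    refine (norm_integral_le_of_norm_le hI (ae_of_all _ fun ω => ?_)).trans (le_of_eq ?_)
    · by_cases hω : ε ≤ |Y i ω - X i ω|
      · rw [Set.indicator_of_mem (by exact hω), ← dist_eq_norm]
        have := hC (Y i ω) (X i ω)
        have : 0 ≤ (L : ℝ) * ε := by positivity
        linarith
      · rw [Set.indicator_of_notMem (by exact hω), add_zero]
        have h1 := hL.dist_le_mul (Y i ω) (X i ω)
        rw [dist_eq_norm, Real.dist_eq] at h1
        refine h1.trans ?_
        gcongr
        exact (not_le.1 hω).le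
    · rw [integral_add (integrable_const _) ((integrable_const C).indicator hA),
        integral_indicator_const _ hA]
      simp [mul_comm]
  have hdiff : Tendsto (fun i => ∫ x, F x ∂((Q i).map (hY i).aemeasurable : Measure ℝ)
        - ∫ x, F x ∂((Q i).map (hX i).aemeasurable : Measure ℝ)) l (𝓝 0) := by
    rw [Metric.tendsto_nhds]
    intro η hη
    have hε : 0 < η / (2 * (L + 1)) := by positivity
    have hlt : (L : ℝ) * (η / (2 * (L + 1))) + C * 0 < η := by
      have : (L : ℝ) * (η / (2 * (L + 1))) = η * (L / (2 * (L + 1))) := by ring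
      rw [this, mul_zero, add_zero]
      have h2 : (L : ℝ) / (2 * (L + 1)) < 1 := by
        rw [div_lt_one (by positivity)]
        have := L.coe_nonneg
        linarith
      nlinarith
    filter_upwards [(((hsub _ hε).const_mul C).const_add
      ((L : ℝ) * (η / (2 * (L + 1))))).eventually_lt_const hlt] with i hi
    rw [Real.dist_eq, sub_zero]
    exact (hbound i _ hε).trans_lt hi
  simpa using hdiff.add (hlim F ⟨C, hC⟩ ⟨L, hL⟩)

/-! ### Variance of the Poisson law -/

/-- Index shift from $n\,r^n/n!=r\cdot r^{n-1}/(n-1)!$. The truncated `n - 1` at `n = 0` is killed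
by the factor `n`. -/
lemma hasSum_mul_poisson {r : ℝ≥0} {f : ℕ → ℝ} {s : ℝ}
    (h : HasSum (fun n => f n * (Real.exp (-r) * r ^ n / n.factorial)) s) :
    HasSum (fun n : ℕ => n * f (n - 1) * (Real.exp (-r) * r ^ n / n.factorial)) (r * s) := by
  rw [← hasSum_nat_add_iff' 1]
  simp only [Finset.range_one, Finset.sum_singleton, Nat.cast_zero, zero_mul, sub_zero,
    add_tsub_cancel_right]
  refine (h.mul_left (r : ℝ)).congr_fun fun n => ?_
  rw [Nat.factorial_succ]
  push_cast
  field_simp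
  ring

lemma hasSum_sq_sub_poisson (r : ℝ≥0) :
    HasSum (fun n : ℕ => ((n : ℝ) - r) ^ 2 * (Real.exp (-r) * r ^ n / n.factorial)) r := by
  have h0 : HasSum (fun n : ℕ => 1 * (Real.exp (-r) * r ^ n / n.factorial)) 1 := by
    simpa using hasSum_one_poissonMeasure r
  have h1 := hasSum_mul_poisson (f := fun _ => 1) h0
  have h2 := hasSum_mul_poisson (f := fun n => n) (by simpa using h1)
  -- $(n-r)^2=n(n-1)+(1-2r)n+r^2$.
  have h3 := (h2.add (h1.mul_left (1 - 2 * r : ℝ))).add (h0.mul_left ((r : ℝ) ^ 2))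
  rw [show (r : ℝ) * r + (1 - 2 * r) * (r * 1) + r ^ 2 * 1 = r by ring] at h3
  refine h3.congr_fun fun n => ?_
  rcases n with _ | n
  · simp
  · push_cast
    ring

lemma integrable_sq_sub_poissonMeasure (r : ℝ≥0) :
    Integrable (fun n : ℕ => ((n : ℝ) - r) ^ 2) (poissonMeasure r) := by
  rw [integrable_poissonMeasure_iff]
  have := (hasSum_sq_sub_poisson r).summable
  refine this.congr fun n => ?_
  rw [Real.norm_of_nonneg (sq_nonneg _), mul_comm]

lemma integral_sq_sub_poissonMeasure (r : ℝ≥0) :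
    ∫ n : ℕ, ((n : ℝ) - r) ^ 2 ∂poissonMeasure r = r := by
  rw [integral_poissonMeasure]
  refine Eq.trans ?_ (hasSum_sq_sub_poisson r).tsum_eq
  congr 1 with n
  rw [smul_eq_mul, mul_comm]

/-! ### Quadratic approximation of `pairStat` -/

/-- With the logarithms expanded to third order, the odd powers cancel and $t^2+\tfrac23t^4$
remains. The remainders, at most $2t^4$ each, carry weights $1\pm t$ and add at most $4t^4$. -/
lemma abs_mul_log_add_mul_log_sub_sq_le {t : ℝ} (ht : |t| ≤ 1 / 2) :
    |(1 + t) * Real.log (1 + t) + (1 - t) * Real.log (1 - t) - t ^ 2| ≤ 5 * t ^ 4 := by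
  have hlog {u : ℝ} (hu : |u| ≤ 1 / 2) :
      |u + u ^ 2 / 2 + u ^ 3 / 3 + Real.log (1 - u)| ≤ 2 * u ^ 4 := by
    have h := Real.abs_log_sub_add_sum_range_le (x := u) (by linarith) 3
    have h4 : |u| ^ 4 = u ^ 4 := by rw [← abs_pow]; exact abs_of_nonneg (by positivity)
    norm_num [Finset.sum_range_succ] at h
    rw [h4] at h
    refine h.trans ?_
    rw [div_le_iff₀ (by linarith)]
    have : 0 ≤ u ^ 4 := by positivity
    nlinarith
  have h1 := abs_le.1 (hlog ht)
  have h2 := abs_le.1 (hlog (u := -t) (by rwa [abs_neg]))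
  rw [sub_neg_eq_add] at h2
  have ht' := abs_le.1 ht
  have h4 : 0 ≤ t ^ 4 := by positivity
  obtain ⟨h1a, h1b⟩ := h1
  obtain ⟨h2a, h2b⟩ := h2
  rw [abs_le]
  constructor
  · nlinarith [mul_le_mul_of_nonneg_left h1a (by linarith : 0 ≤ 1 - t),
      mul_le_mul_of_nonneg_left h2a (by linarith : 0 ≤ 1 + t)]
  · nlinarith [mul_le_mul_of_nonneg_left h1b (by linarith : 0 ≤ 1 - t),
      mul_le_mul_of_nonneg_left h2b (by linarith : 0 ≤ 1 + t)]

lemma pairStat_eq {a b : ℕ} (hab : 0 < a + b) :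
    pairStat (a, b) = ((a : ℝ) + b) *
      ((1 + ((a : ℝ) - b) / (a + b)) * Real.log (1 + ((a : ℝ) - b) / (a + b))
        + (1 - ((a : ℝ) - b) / (a + b)) * Real.log (1 - ((a : ℝ) - b) / (a + b))) := by
  have hN : (0 : ℝ) < (a : ℝ) + b := by exact_mod_cast hab
  have hlog (c : ℝ) : c * Real.log (c / ((a + b) / 2))
      = c * Real.log c - c * Real.log (((a : ℝ) + b) / 2) := by
    rcases eq_or_ne c 0 with rfl | hc
    · simp
    · rw [Real.log_div hc (by positivity)]; ring
  have e1 : 1 + ((a : ℝ) - b) / (a + b) = a / ((a + b) / 2) := by field_simp; ring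
  have e2 : 1 - ((a : ℝ) - b) / (a + b) = b / ((a + b) / 2) := by field_simp; ring
  have h1 := hlog a
  have h2 := hlog b
  rw [e1, e2, pairStat]
  have : ((a : ℝ) + b) * (a / ((a + b) / 2) * Real.log (a / ((a + b) / 2))
      + b / ((a + b) / 2) * Real.log (b / ((a + b) / 2)))
      = 2 * (a * Real.log (a / ((a + b) / 2)) + b * Real.log (b / ((a + b) / 2))) := by
    field_simp
  rw [this, h1, h2]
  ring

/-- Here $\Lambda$ stands for the expected total $2r$. The first error term is the quartic remainder
at $t=D/N$, the second the cost of replacing $N$ by $\Lambda$. The condition $16K\le\Lambda$ ensures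
$N\ge\Lambda/2$ and then $t^2\le4K/\Lambda\le1/4$. -/
lemma abs_pairStat_sub_le {a b : ℕ} {K Λ : ℝ} (hK : 0 < K) (hΛ : 16 * K ≤ Λ)
    (hD : ((a : ℝ) - b) ^ 2 ≤ Λ * K) (hN : ((a : ℝ) + b - Λ) ^ 2 ≤ Λ * K) :
    |pairStat (a, b) - ((a : ℝ) - b) ^ 2 / Λ| ≤ 40 * K ^ 2 / Λ + 2 * K * √(K / Λ) := by
  have hΛ0 : 0 < Λ := by linarith
  set N : ℝ := (a : ℝ) + b with hNdef
  set D : ℝ := (a : ℝ) - b with hDdef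
  have hNΛ : |N - Λ| ≤ Λ * √(K / Λ) := by
    refine abs_le_of_sq_le_sq ?_ (by positivity)
    rw [mul_pow, Real.sq_sqrt (by positivity)]
    refine hN.trans (le_of_eq ?_)
    field_simp
  have hsq : √(K / Λ) ≤ 1 / 4 := by
    rw [Real.sqrt_le_left (by norm_num), div_le_iff₀ hΛ0]
    linarith
  have hNlow : Λ / 2 ≤ N := by
    have := (abs_le.1 hNΛ).1
    nlinarith
  have hN0 : 0 < N := by linarith
  have hN2 : Λ ^ 2 / 4 ≤ N ^ 2 := by nlinarith
  have hN3 : Λ ^ 3 / 8 ≤ N ^ 3 := by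
    calc Λ ^ 3 / 8 = (Λ / 2) ^ 3 := by ring
      _ ≤ N ^ 3 := by gcongr
  have ht : |D / N| ≤ 1 / 2 := by
    refine abs_le_of_sq_le_sq ?_ (by norm_num)
    rw [div_pow, div_le_iff₀ (by positivity)]
    nlinarith
  have hpos : 0 < a + b := by exact_mod_cast hNdef ▸ hN0
  have h1 : |pairStat (a, b) - D ^ 2 / N| ≤ 40 * K ^ 2 / Λ := by
    have h := abs_mul_log_add_mul_log_sub_sq_le ht
    rw [pairStat_eq hpos]
    have e : N * ((1 + D / N) * Real.log (1 + D / N) + (1 - D / N) * Real.log (1 - D / N))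
        - D ^ 2 / N = N * ((1 + D / N) * Real.log (1 + D / N)
          + (1 - D / N) * Real.log (1 - D / N) - (D / N) ^ 2) := by
      field_simp
    rw [e, abs_mul, abs_of_pos hN0]
    calc N * _ ≤ N * (5 * (D / N) ^ 4) := by gcongr
      _ = 5 * (D ^ 2) ^ 2 / N ^ 3 := by field_simp
      _ ≤ 5 * (Λ * K) ^ 2 / (Λ ^ 3 / 8) := by gcongr
      _ = 40 * K ^ 2 / Λ := by field_simp; ring
  have h2 : |D ^ 2 / N - D ^ 2 / Λ| ≤ 2 * K * √(K / Λ) := by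
    have e : D ^ 2 / N - D ^ 2 / Λ = D ^ 2 * (Λ - N) / (N * Λ) := by field_simp
    rw [e, abs_div, abs_mul, abs_of_nonneg (sq_nonneg D), abs_of_pos (by positivity : 0 < N * Λ),
      abs_sub_comm]
    calc D ^ 2 * |N - Λ| / (N * Λ) ≤ (Λ * K) * (Λ * √(K / Λ)) / (Λ / 2 * Λ) := by gcongr
      _ = 2 * K * √(K / Λ) := by field_simp
  calc _ = |(pairStat (a, b) - D ^ 2 / N) + (D ^ 2 / N - D ^ 2 / Λ)| := by ring_nf
    _ ≤ _ := (abs_add_le _ _).trans (add_le_add h1 h2)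

/-! ### Limit law of one pair -/

/-- The law of two independent Poisson random variables with the same rate. -/
noncomputable def poissonPair (r : ℝ≥0) : ProbabilityMeasure (ℕ × ℕ) :=
  ⟨(poissonMeasure r).prod (poissonMeasure r), inferInstance⟩

lemma coe_poissonPair (r : ℝ≥0) :
    (poissonPair r : Measure (ℕ × ℕ)) = (poissonMeasure r).prod (poissonMeasure r) := rfl

/-- The normalised difference of the counts of a pair. -/
noncomputable def scaledDiff (r : ℝ≥0) (ab : ℕ × ℕ) : ℝ := ((ab.1 : ℝ) - ab.2) / √(2 * r)

lemma measurable_scaledDiff (r : ℝ≥0) : Measurable (scaledDiff r) := .of_discrete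

lemma measurable_pairStat : Measurable pairStat := .of_discrete

lemma integral_poissonMeasure_cexp (r : ℝ≥0) (t : ℝ) :
    ∫ n : ℕ, Complex.exp (t * n * Complex.I) ∂poissonMeasure r
      = Complex.exp (r * (Complex.exp (t * Complex.I) - 1)) := by
  rw [← charFun_map_cast_poissonMeasure, charFun_apply_real,
    integral_map .of_discrete (by fun_prop)]
  simp

lemma charFun_map_scaledDiff (r : ℝ≥0) (t : ℝ) :
    charFun ((poissonPair r : Measure (ℕ × ℕ)).map (scaledDiff r)) t
      = Complex.exp ((2 * r * (Real.cos (t / √(2 * r)) - 1) : ℝ)) := by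
  rw [charFun_apply_real, integral_map .of_discrete (by fun_prop), coe_poissonPair]
  have h (z : ℕ × ℕ) : Complex.exp (t * scaledDiff r z * Complex.I)
      = Complex.exp ((t / √(2 * r) : ℝ) * z.1 * Complex.I)
        * Complex.exp ((-(t / √(2 * r)) : ℝ) * z.2 * Complex.I) := by
    rw [← Complex.exp_add]
    congr 1
    simp only [scaledDiff]
    push_cast
    ring
  simp only [h]
  rw [integral_prod_mul (fun n : ℕ => Complex.exp ((t / √(2 * r) : ℝ) * n * Complex.I))
    (fun n : ℕ => Complex.exp ((-(t / √(2 * r)) : ℝ) * n * Complex.I)),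
    integral_poissonMeasure_cexp, integral_poissonMeasure_cexp, ← Complex.exp_add]
  congr 1
  push_cast
  rw [Complex.cos]
  ring

lemma tendsto_two_mul_sqrt_inv (t : ℝ) :
    Tendsto (fun r : ℝ≥0 => t / (2 * √(2 * r))) atTop (𝓝 0) := by
  refine Tendsto.const_div_atTop ?_ t
  refine Tendsto.const_mul_atTop two_pos (Real.tendsto_sqrt_atTop.comp ?_)
  exact Tendsto.const_mul_atTop two_pos (NNReal.tendsto_coe_atTop.2 tendsto_id)

lemma tendsto_two_mul_cos_sub_one (t : ℝ) :
    Tendsto (fun r : ℝ≥0 => 2 * r * (Real.cos (t / √(2 * r)) - 1)) atTop (𝓝 (-(t ^ 2 / 2))) := by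
  -- By the half-angle formula the expression equals
  -- $-\tfrac{t^2}{2}\,\mathrm{sinc}^2(t/(2\sqrt{2r}))$, so continuity of sinc at $0$ suffices.
  have hs := (Real.continuous_sinc.tendsto 0).comp (tendsto_two_mul_sqrt_inv t)
  have hlim := (hs.pow 2).const_mul (-(t ^ 2 / 2))
  rw [Real.sinc_zero, one_pow, mul_one] at hlim
  refine hlim.congr' ?_
  filter_upwards [eventually_gt_atTop 0] with r hr
  have hr' : (0 : ℝ) < r := hr
  have hq : (√(2 * r)) ^ 2 = 2 * r := Real.sq_sqrt (by positivity)
  have hq0 : 0 < √(2 * (r : ℝ)) := by positivity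
  set q := √(2 * (r : ℝ))
  have hcos : Real.cos (t / q) - 1 = -2 * Real.sin (t / (2 * q)) ^ 2 := by
    have h1 : t / q = 2 * (t / (2 * q)) := by field_simp
    rw [h1, Real.cos_two_mul, Real.cos_sq']
    ring
  have hsin : Real.sin (t / (2 * q)) = t / (2 * q) * Real.sinc (t / (2 * q)) := by
    rcases eq_or_ne t 0 with rfl | ht
    · simp
    · rw [Real.sinc_of_ne_zero (by positivity)]
      field_simp
  change -(t ^ 2 / 2) * Real.sinc (t / (2 * q)) ^ 2 = _
  rw [hcos, hsin, ← hq]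
  field_simp

/-- The standard normal distribution. -/
noncomputable def stdGaussian : ProbabilityMeasure ℝ := ⟨gaussianReal 0 1, inferInstance⟩

lemma coe_stdGaussian : (stdGaussian : Measure ℝ) = gaussianReal 0 1 := rfl

lemma tendsto_map_scaledDiff :
    Tendsto (fun r => (poissonPair r).map (measurable_scaledDiff r).aemeasurable) atTop
      (𝓝 stdGaussian) := by
  -- Lévy's continuity theorem is applied along sequences of rates.
  refine tendsto_of_seq_tendsto fun u hu => ?_
  rw [ProbabilityMeasure.tendsto_iff_tendsto_charFun]
  intro t
  simp only [Function.comp, ProbabilityMeasure.toMeasure_map, charFun_map_scaledDiff,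
    coe_stdGaussian, charFun_gaussianReal]
  have h := (Complex.continuous_ofReal.tendsto _).comp ((tendsto_two_mul_cos_sub_one t).comp hu)
  have h' := (Complex.continuous_exp.tendsto _).comp h
  have hexp : (t * (0 : ℝ) * Complex.I - ((1 : ℝ≥0) : ℝ) * (t : ℂ) ^ 2 / 2 : ℂ)
      = ((-(t ^ 2 / 2) : ℝ) : ℂ) := by
    push_cast
    ring
  rw [hexp]
  exact h'

/-- Markov's inequality: the sum of squares has mean $2r$. -/
lemma measureReal_poissonPair_le (r : ℝ≥0) (hr : 0 < r) {K : ℝ} (hK : 0 < K) :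
    (poissonPair r : Measure (ℕ × ℕ)).real
      {ab | r * K ≤ ((ab.1 : ℝ) - r) ^ 2 + ((ab.2 : ℝ) - r) ^ 2} ≤ 2 / K := by
  have hr' : (0 : ℝ) < r := hr
  rw [coe_poissonPair]
  have h1 : Integrable (fun ab : ℕ × ℕ => ((ab.1 : ℝ) - r) ^ 2)
      ((poissonMeasure r).prod (poissonMeasure r)) :=
    (integrable_sq_sub_poissonMeasure r).comp_fst _
  have h2 : Integrable (fun ab : ℕ × ℕ => ((ab.2 : ℝ) - r) ^ 2)
      ((poissonMeasure r).prod (poissonMeasure r)) :=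
    (integrable_sq_sub_poissonMeasure r).comp_snd _
  have hmk := mul_meas_ge_le_integral_of_nonneg
    (ae_of_all _ fun ab : ℕ × ℕ => add_nonneg (sq_nonneg ((ab.1 : ℝ) - r))
      (sq_nonneg ((ab.2 : ℝ) - r))) (h1.add h2) (r * K)
  have hI : ∫ ab : ℕ × ℕ, ((ab.1 : ℝ) - r) ^ 2 + ((ab.2 : ℝ) - r) ^ 2
      ∂(poissonMeasure r).prod (poissonMeasure r) = 2 * r := by
    rw [integral_add h1 h2, integral_fun_fst (fun n : ℕ => ((n : ℝ) - r) ^ 2),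
      integral_fun_snd (fun n : ℕ => ((n : ℝ) - r) ^ 2), integral_sq_sub_poissonMeasure]
    simp
    ring
  change _ ≤ ∫ ab : ℕ × ℕ, ((ab.1 : ℝ) - r) ^ 2 + ((ab.2 : ℝ) - r) ^ 2 ∂_ at hmk
  rw [hI] at hmk
  rw [le_div_iff₀ hK]
  nlinarith

lemma tendsto_measureReal_pairStat_sub {ε : ℝ} (hε : 0 < ε) :
    Tendsto (fun r => (poissonPair r : Measure (ℕ × ℕ)).real
      {ab | ε ≤ |pairStat ab - scaledDiff r ab ^ 2|}) atTop (𝓝 0) := by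
  rw [Metric.tendsto_nhds]
  intro η hη
  -- Makes the exceptional probability $2/K$ equal to $\eta/2$.
  set K : ℝ := 4 / η
  have hK : 0 < K := by positivity
  have hΛ : Tendsto (fun r : ℝ≥0 => 2 * (r : ℝ)) atTop atTop :=
    Tendsto.const_mul_atTop two_pos (NNReal.tendsto_coe_atTop.2 tendsto_id)
  have hlim : Tendsto (fun r : ℝ≥0 => 40 * K ^ 2 / (2 * (r : ℝ)) + 2 * K * √(K / (2 * r)))
      atTop (𝓝 0) := by
    have h1 : Tendsto (fun r : ℝ≥0 => 40 * K ^ 2 / (2 * (r : ℝ))) atTop (𝓝 0) :=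
      hΛ.const_div_atTop _
    have h2 : Tendsto (fun r : ℝ≥0 => √(K / (2 * r))) atTop (𝓝 0) := by
      have := (Real.continuous_sqrt.tendsto 0).comp (hΛ.const_div_atTop K)
      rwa [Real.sqrt_zero] at this
    simpa using h1.add (h2.const_mul (2 * K))
  filter_upwards [hlim.eventually_lt_const hε, hΛ.eventually_ge_atTop (16 * K),
    eventually_gt_atTop 0] with r h1 h2 hr
  rw [Real.dist_eq, sub_zero, abs_of_nonneg measureReal_nonneg]
  have hsub : {ab : ℕ × ℕ | ε ≤ |pairStat ab - scaledDiff r ab ^ 2|}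
      ⊆ {ab | r * K ≤ ((ab.1 : ℝ) - r) ^ 2 + ((ab.2 : ℝ) - r) ^ 2} := by
    rintro ⟨a, b⟩ hab
    by_contra hcon
    simp only [Set.mem_ofPred_eq, not_le] at hab hcon
    -- Both bounds come from $(a-b)^2+(a+b-2r)^2=2\left((a-r)^2+(b-r)^2\right)$.
    have hD : ((a : ℝ) - b) ^ 2 ≤ 2 * r * K := by
      nlinarith [sq_nonneg ((a : ℝ) + b - 2 * r)]
    have hN : ((a : ℝ) + b - 2 * r) ^ 2 ≤ 2 * r * K := by
      nlinarith [sq_nonneg ((a : ℝ) - b)]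
    have hle := abs_pairStat_sub_le hK h2 hD hN
    rw [scaledDiff, div_pow, Real.sq_sqrt (by positivity)] at hab
    linarith
  calc _ ≤ _ := measureReal_mono hsub
    _ ≤ 2 / K := measureReal_poissonPair_le r hr hK
    _ = η / 2 := by simp only [K]; field_simp; norm_num
    _ < η := by linarith

/-- The law of the contribution of one pair to the test statistic. -/
noncomputable def pairStatLaw (r : ℝ≥0) : ProbabilityMeasure ℝ :=
  (poissonPair r).map measurable_pairStat.aemeasurable

/-- The law of the square of a standard normal random variable. -/
noncomputable def sqGaussian : ProbabilityMeasure ℝ :=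
  stdGaussian.map (f := fun x : ℝ => x ^ 2) (by fun_prop)

lemma tendsto_pairStatLaw : Tendsto pairStatLaw atTop (𝓝 sqGaussian) := by
  refine tendsto_map_of_tendsto_measureReal_abs_sub
    (X := fun r ab => scaledDiff r ab ^ 2) (Y := fun _ => pairStat)
    (fun _ => .of_discrete) (fun _ => measurable_pairStat) ?_
    fun ε hε => tendsto_measureReal_pairStat_sub hε
  have h := ProbabilityMeasure.tendsto_map_of_tendsto_of_continuous _ _ tendsto_map_scaledDiff
    (continuous_pow 2)
  refine Tendsto.congr (fun r => Subtype.ext ?_) h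
  exact (Measure.map_map (measurable_id.pow_const 2) (measurable_scaledDiff r))

/-! ### Summation over the pairs and the law of $R$ -/

/-- The law of the sum of independent real random variables. -/
noncomputable def sumLaw {P : ℕ} (ρ : Fin P → ProbabilityMeasure ℝ) : ProbabilityMeasure ℝ :=
  (ProbabilityMeasure.pi ρ).map (f := fun y => ∑ p, y p)
    (Measurable.aemeasurable (by fun_prop))

lemma continuous_sumLaw {P : ℕ} : Continuous (sumLaw (P := P)) :=
  (ProbabilityMeasure.continuous_map (by fun_prop)).comp ProbabilityMeasure.continuous_pi

lemma sumLaw_sqGaussian (P : ℕ) :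
    (sumLaw (P := P) fun _ => sqGaussian : Measure ℝ) = chiSquared P := by
  rw [sumLaw, ProbabilityMeasure.toMeasure_map, ProbabilityMeasure.toMeasure_pi, chiSquared]
  simp only [sqGaussian, ProbabilityMeasure.toMeasure_map, coe_stdGaussian]
  rw [← Measure.pi_map_pi (fun _ => by fun_prop), Measure.map_map (by fun_prop) (by fun_prop)]
  rfl

/-- The test statistic as a function of the total counts. -/
noncomputable def totalStat {P : ℕ} (s : Fin (2 * P) → ℕ) : ℝ :=
  ∑ p, pairStat (s (fstIdx p), s (sndIdx p))

lemma measurable_totalStat {P : ℕ} : Measurable (totalStat (P := P)) :=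
  Finset.measurable_sum _ fun p _ => measurable_pairStat.comp (by fun_prop)

lemma IsSample.hasLaw_statR {Ω : Type*} [MeasurableSpace Ω] {Pr : Measure Ω}
    [IsProbabilityMeasure Pr] {M P : ℕ} {μ : Fin (2 * P) → ℝ≥0}
    {X : Fin M → Ω → (Fin (2 * P) → ℕ)} (hM : 1 ≤ M) (hP : 1 ≤ P) (h : IsSample Pr μ X) :
    HasLaw (fun ω => statR fun m => X m ω)
      ((Measure.pi fun i => poissonMeasure (μ i * M)).map totalStat) Pr := by
  simp only [statR_eq hM hP]
  exact HasLaw.comp (Y := totalStat) ⟨measurable_totalStat.aemeasurable, rfl⟩ (h.hasLaw_total hM)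

lemma map_totalStat_pi_paired {P M : ℕ} (ν : Fin P → ℝ≥0) :
    (Measure.pi fun i => poissonMeasure (paired ν i * M)).map totalStat
      = (sumLaw fun p => pairStatLaw (ν p * M) : Measure ℝ) := by
  have h : totalStat = (fun y : Fin P → ℝ => ∑ p, y p) ∘ (fun y p => pairStat (y p)) ∘
      (fun (s : Fin (2 * P) → ℕ) p => (s (fstIdx p), s (sndIdx p))) := rfl
  have hm : Measurable fun (y : Fin P → ℕ × ℕ) p => pairStat (y p) :=
    measurable_pi_lambda _ fun p => measurable_pairStat.comp (measurable_pi_apply p)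
  rw [h, ← Measure.map_map (by fun_prop) (hm.comp (by fun_prop)),
    ← Measure.map_map hm (by fun_prop), map_pairs_pi]
  simp only [paired_fstIdx, paired_sndIdx]
  rw [sumLaw, ProbabilityMeasure.toMeasure_map, ProbabilityMeasure.toMeasure_pi]
  congr 1
  rw [Measure.pi_map_pi fun _ => measurable_pairStat.aemeasurable]
  rfl

end PoissonPairs

open PoissonPairs in
theorem theorem3p2 (P : ℕ) (hP : 1 ≤ P) :
    -- the law of `R` depends on `M` and the `μ i` only through the products `μ i * M`
    (∀ {Ω : Type*} {Ω' : Type*} [MeasurableSpace Ω] [MeasurableSpace Ω']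
        (Pr : Measure Ω) (Pr' : Measure Ω') [IsProbabilityMeasure Pr] [IsProbabilityMeasure Pr']
        (M M' : ℕ) (_ : 1 ≤ M) (_ : 1 ≤ M') (μ μ' : Fin (2 * P) → ℝ≥0)
        (X : Fin M → Ω → (Fin (2 * P) → ℕ)) (X' : Fin M' → Ω' → (Fin (2 * P) → ℕ))
        (_ : IsSample Pr μ X) (_ : IsSample Pr' μ' X')
        (_ : ∀ i, μ i * M = μ' i * M'),
        IdentDistrib (fun ω => statR fun m => X m ω) (fun ω => statR fun m => X' m ω) Pr Pr') ∧
    -- under the null hypothesis, `R → χ²_P` in distribution as all `ν i * M → ∞`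
    (∀ {ι : Type*} (l : Filter ι) {Ω : ι → Type*} [∀ n, MeasurableSpace (Ω n)]
        (Pr : ∀ n, Measure (Ω n)) [∀ n, IsProbabilityMeasure (Pr n)]
        (M : ι → ℕ) (_ : ∀ n, 1 ≤ M n) (ν : ι → Fin P → ℝ≥0) (_ : ∀ n i, ν n i ≠ 0)
        (X : ∀ n, Fin (M n) → Ω n → (Fin (2 * P) → ℕ))
        (_ : ∀ n, IsSample (Pr n) (paired (ν n)) (X n))
        (_ : ∀ i, Tendsto (fun n => ν n i * M n) l atTop),
        TendstoInDistribution (fun n ω => statR fun m => X n m ω) l id Pr (chiSquared P)) := by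
  refine ⟨?_, ?_⟩
  · intro Ω Ω' _ _ Pr Pr' _ _ M M' hM hM' μ μ' X X' hX hX' h
    have hlaw := hX.hasLaw_statR hM hP
    have hlaw' := hX'.hasLaw_statR hM' hP
    simp only [h] at hlaw
    exact ⟨hlaw.aemeasurable, hlaw'.aemeasurable, hlaw.map_eq.trans hlaw'.map_eq.symm⟩
  · intro ι l Ω _ Pr _ M hM ν _ X hX hlim
    have hlaw n := (hX n).hasLaw_statR (hM n) hP
    refine ⟨fun n => (hlaw n).aemeasurable, aemeasurable_id, ?_⟩
    -- Each coordinate composes the one-parameter limit with its own rate, so `l` can be any filter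
    -- and the rates need not be comparable.
    have key : Tendsto (fun n => sumLaw fun p => pairStatLaw (ν n p * M n)) l
        (nhds (sumLaw fun _ => sqGaussian)) :=
      (continuous_sumLaw.tendsto _).comp
        (tendsto_pi_nhds.2 fun p => tendsto_pairStatLaw.comp (hlim p))
    have hχ : (⟨(chiSquared P).map id, Measure.isProbabilityMeasure_map aemeasurable_id⟩ :
        ProbabilityMeasure ℝ) = sumLaw fun _ => sqGaussian :=
      Subtype.ext (Measure.map_id.trans (sumLaw_sqGaussian P).symm)
    rw [hχ]
    exact key.congr fun n =>
      (Subtype.ext ((hlaw n).map_eq.trans (map_totalStat_pi_paired (ν n)))).symm
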